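/- Throughout, subcategories are full and closed under isomorphisms. A short exact sequence $0\to K\xrightarrow{i} M\xrightarrow{p} Q\to 0$ in an additive category is a pair of morphisms such that $i$ is a kernel of $p$ and $p$ is a cokernel of $i$. A torsion pair in an additive category $\mathcal{B}$ is a pair $(\mathcal{T},\mathcal{F})$ of subcategories with $\mathrm{Hom}_{\mathcal{B}}(\mathcal{T},\mathcal{F})=0$ such that every object $M$ of $\mathcal{B}$ lies in a short exact sequence $0\to T\to M\to F\to 0$ in $\mathcal{B}$ with $T\in\mathcal{T}$ and $F\in\mathcal{F}$. A subcategory $\mathcal{X}$ is functorially finite in $\mathcal{B}$ if every object $M$ of $\mathcal{B}$ admits a morphism $X\to M$ with $X\in\mathcal{X}$ through which every morphism from an object of $\mathcal{X}$ to $M$ factors, and a morphism $M\to X'$ with $X'\in\mathcal{X}$ through which every morphism from $M$ to an object of $\mathcal{X}$ factors. A torsion pair $(\mathcal{T},\mathcal{F})$ in $\mathcal{B}$ is functorially finite if both $\mathcal{T}$ and $\mathcal{F}$ are functorially finite in $\mathcal{B}$. For subcategories $\mathcal{X},\mathcal{Y}$ of $\mathcal{B}$, let $\mathcal{X}\ast\mathcal{Y}$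 be the subcategory of all objects $M$ for which there is a short exact sequence $0\to M'\to M\to M''\to 0$ with $M'\in\mathcal{X}$ and $M''\in\mathcal{Y}$. **Proposition 4.6.** Let $\mathcal{A}$ be an abelian category, and let $(\mathcal{C},\mathcal{D})$ and $(\mathcal{C}',\mathcal{D}')$ be torsion pairs in $\mathcal{A}$ with $\mathcal{C}\subseteq\mathcal{C}'$ (twin torsion pairs). Their heart is the full subcategory $\mathcal{C}'\cap\mathcal{D}$ of $\mathcal{A}$. (a) If $(\mathcal{X},\mathcal{Y})$ is a functorially finite torsion pair in $\mathcal{A}$ such that $\mathcal{C}\subseteq\mathcal{X}\subseteq\mathcal{C}'$, then $(\mathcal{X}\cap\mathcal{D},\,\mathcal{Y}\cap\mathcal{C}')$ is a functorially finite torsion pair in $\mathcal{C}'\cap\mathcal{D}$. (b) Suppose that $\mathcal{A}$ has enough projectives and enough injectives and that $(\mathcal{C},\mathcal{D})$ and $(\mathcal{C}',\mathcal{D}')$ are functorially finite torsion pairs in $\mathcal{A}$. If $(\mathcal{T},\mathcal{F})$ is a functorially finite torsion pair in $\mathcal{C}'\cap\mathcal{D}$, then $(\mathcal{C}\ast\mathcal{T},\,\mathcal{F}\ast\mathcal{D}')$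 is a functorially finite torsion pair in $\mathcal{A}$. -/

import Mathlib

open CategoryTheory CategoryTheory.Limits

universe v u

namespace HeartTorsion

section General

variable {B : Type u} [Category.{v} B] [Preadditive B]

/-- `0 ⟶ K ⟶ M ⟶ Q ⟶ 0` is a short exact sequence in a (pre-abelian) category:
`i` is a kernel of `p` and `p` is a cokernel of `i`. -/
def IsShortExactSeq {K M Q : B} (i : K ⟶ M) (p : M ⟶ Q) : Prop :=
  ∃ w : i ≫ p = 0,
    Nonempty (IsLimit (KernelFork.ofι i w)) ∧ Nonempty (IsColimit (CokernelCofork.ofπ p w))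

/-- A torsion pair `(T, F)`. Full subcategories are given by (isomorphism-closed)
properties of objects. -/
structure IsTorsionPair (T F : ObjectProperty B) : Prop where
  isoClosed_torsion : T.IsClosedUnderIsomorphisms
  isoClosed_torsionfree : F.IsClosedUnderIsomorphisms
  hom_eq_zero : ∀ ⦃X Y : B⦄, T X → F Y → ∀ f : X ⟶ Y, f = 0
  exists_shortExact : ∀ M : B, ∃ (X Y : B) (i : X ⟶ M) (p : M ⟶ Y),
    T X ∧ F Y ∧ IsShortExactSeq i p

/-- `α : X ⟶ M` is a right `P`-approximation of `M`. -/
def IsRightApprox (P : ObjectProperty B) {X M : B} (α : X ⟶ M) : Prop :=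
  P X ∧ ∀ ⦃X' : B⦄, P X' → ∀ f : X' ⟶ M, ∃ g : X' ⟶ X, g ≫ α = f

/-- `α : M ⟶ X` is a left `P`-approximation of `M`. -/
def IsLeftApprox (P : ObjectProperty B) {M X : B} (α : M ⟶ X) : Prop :=
  P X ∧ ∀ ⦃X' : B⦄, P X' → ∀ f : M ⟶ X', ∃ g : X ⟶ X', α ≫ g = f

/-- Every object has a right `P`-approximation. -/
def ContravariantlyFinite (P : ObjectProperty B) : Prop :=
  ∀ M : B, ∃ (X : B) (α : X ⟶ M), IsRightApprox P α

/-- Every object has a left `P`-approximation. -/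
def CovariantlyFinite (P : ObjectProperty B) : Prop :=
  ∀ M : B, ∃ (X : B) (α : M ⟶ X), IsLeftApprox P α

def FunctoriallyFinite (P : ObjectProperty B) : Prop :=
  ContravariantlyFinite P ∧ CovariantlyFinite P

/-- A torsion pair both of whose classes are functorially finite. -/
structure IsFunctoriallyFiniteTorsionPair (T F : ObjectProperty B) : Prop where
  isTorsionPair : IsTorsionPair T F
  torsion_finite : FunctoriallyFinite T
  torsionfree_finite : FunctoriallyFinite F

/-- `P ∗ Q`: the objects `M` with a short exact sequence `0 ⟶ M' ⟶ M ⟶ M'' ⟶ 0`,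
`M'` in `P` and `M''` in `Q`. -/
def star (P Q : ObjectProperty B) : ObjectProperty B := fun M =>
  ∃ (M' M'' : B) (i : M' ⟶ M) (p : M ⟶ M''), P M' ∧ Q M'' ∧ IsShortExactSeq i p

/-- `(T, F)` consists of subcategories of the full subcategory `H` of `B` and is a functorially
finite torsion pair in the category `H`: the Hom-vanishing, the short exact sequences (kernels and
cokernels) and the approximations are all those of the category `H`. -/
structure IsFunctoriallyFiniteTorsionPairIn (H T F : ObjectProperty B) : Prop where
  torsion_le : T ≤ H
  torsionfree_le : F ≤ H
  isFunctoriallyFinite :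
    IsFunctoriallyFiniteTorsionPair (B := H.FullSubcategory)
      (T.inverseImage H.ι) (F.inverseImage H.ι)

/-- Twin torsion pairs `[(C, D), (C', D')]`. -/
structure AreTwinTorsionPairs (C D C' D' : ObjectProperty B) : Prop where
  fst : IsTorsionPair C D
  snd : IsTorsionPair C' D'
  le : C ≤ C'

end General

end HeartTorsion

namespace HeartTorsion

/-! ### Approximations and full subcategories -/

section Approximations

variable {B : Type u} [Category.{v} B] {H P : ObjectProperty B}

/-! Torsion classes are closed under quotients and torsion-free classes under subobjects. For (a),
the `(X, Y)`-sequence of an object of the heart therefore stays in the heart.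

For (b), the crux is `isShortExactSeq_of_heart`: a short exact sequence of the heart is short exact
in `A`. Its homology in `A` is both a quotient of the kernel lying in `D'` and a subobject of the
cokernel lying in `C`, hence zero. An object `M` has a filtration with factors in `C`, the heart and
`D'`; splitting the middle factor by `(T, F)` gives the sequence for `(C ∗ T, F ∗ D')`.

One approximation on each side of a torsion pair is automatic. For the others, the heart is
functorially finite, so `T` and `F` inherit approximations in `A`, and extensions preserve them
given enough projectives or injectives. -/

lemma CovariantlyFinite.inverseImage (hle : P ≤ H) (h : CovariantlyFinite P) :
    CovariantlyFinite (P.inverseImage H.ι) := by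
  intro M
  obtain ⟨X, α, hX, hα⟩ := h M.obj
  refine ⟨⟨X, hle _ hX⟩, ObjectProperty.homMk α, hX, fun X' hX' f => ?_⟩
  obtain ⟨g, hg⟩ := hα hX' f.hom
  exact ⟨ObjectProperty.homMk g, by ext; exact hg⟩

lemma ContravariantlyFinite.inverseImage (hle : P ≤ H) (h : ContravariantlyFinite P) :
    ContravariantlyFinite (P.inverseImage H.ι) := by
  intro M
  obtain ⟨X, α, hX, hα⟩ := h M.obj
  refine ⟨⟨X, hle _ hX⟩, ObjectProperty.homMk α, hX, fun X' hX' f => ?_⟩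
  obtain ⟨g, hg⟩ := hα hX' f.hom
  exact ⟨ObjectProperty.homMk g, by ext; exact hg⟩

/-- Approximate by `H` first, then by `P` inside `H`; the composite works because `P ≤ H`. -/
lemma CovariantlyFinite.of_inverseImage (hle : P ≤ H) (hH : CovariantlyFinite H)
    (h : CovariantlyFinite (P.inverseImage H.ι)) : CovariantlyFinite P := by
  intro M
  obtain ⟨N, α, hN, hα⟩ := hH M
  obtain ⟨X, β, hX, hβ⟩ := h ⟨N, hN⟩
  refine ⟨X.obj, α ≫ β.hom, hX, fun X' hX' f => ?_⟩
  obtain ⟨g, hg⟩ := hα (hle _ hX') f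
  obtain ⟨g', hg'⟩ := hβ (X' := ⟨X', hle _ hX'⟩) hX' (ObjectProperty.homMk g)
  have hg'' : β.hom ≫ g'.hom = g := congrArg (fun f => f.hom) hg'
  exact ⟨g'.hom, by rw [Category.assoc, hg'', hg]⟩

lemma ContravariantlyFinite.of_inverseImage (hle : P ≤ H) (hH : ContravariantlyFinite H)
    (h : ContravariantlyFinite (P.inverseImage H.ι)) : ContravariantlyFinite P := by
  intro M
  obtain ⟨N, α, hN, hα⟩ := hH M
  obtain ⟨X, β, hX, hβ⟩ := h ⟨N, hN⟩
  refine ⟨X.obj, β.hom ≫ α, hX, fun X' hX' f => ?_⟩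
  obtain ⟨g, hg⟩ := hα (hle _ hX') f
  obtain ⟨g', hg'⟩ := hβ (X' := ⟨X', hle _ hX'⟩) hX' (ObjectProperty.homMk g)
  have hg'' : g'.hom ≫ β.hom = g := congrArg (fun f => f.hom) hg'
  exact ⟨g'.hom, by rw [← Category.assoc, hg'', hg]⟩

end Approximations

section General

variable {B : Type u} [Category.{v} B] [Preadditive B]

/-! ### Short exact sequences in a preadditive category -/

namespace IsShortExactSeq

variable {K M Q : B} {i : K ⟶ M} {p : M ⟶ Q}

lemma zero (h : IsShortExactSeq i p) : i ≫ p = 0 := h.choose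

lemma mono (h : IsShortExactSeq i p) : Mono i := by
  obtain ⟨w, ⟨hi⟩, -⟩ := h
  exact ⟨fun a b hab => Fork.IsLimit.hom_ext hi hab⟩

lemma epi (h : IsShortExactSeq i p) : Epi p := by
  obtain ⟨w, -, ⟨hp⟩⟩ := h
  exact ⟨fun a b hab => Cofork.IsColimit.hom_ext hp hab⟩

lemma exists_lift (h : IsShortExactSeq i p) {W : B} (k : W ⟶ M) (hk : k ≫ p = 0) :
    ∃ l : W ⟶ K, l ≫ i = k := by
  obtain ⟨w, ⟨hi⟩, -⟩ := h
  exact ⟨_, (KernelFork.IsLimit.lift' hi k hk).2⟩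

lemma exists_desc (h : IsShortExactSeq i p) {W : B} (k : M ⟶ W) (hk : i ≫ k = 0) :
    ∃ l : Q ⟶ W, p ≫ l = k := by
  obtain ⟨w, -, ⟨hp⟩⟩ := h
  exact ⟨_, (CokernelCofork.IsColimit.desc' hp k hk).2⟩

/-- Elementary criterion for a pair of morphisms to be a short exact sequence. -/
lemma of_exists [hi : Mono i] [hp : Epi p] (w : i ≫ p = 0)
    (lift : ∀ ⦃W : B⦄ (k : W ⟶ M), k ≫ p = 0 → ∃ l : W ⟶ K, l ≫ i = k)
    (desc : ∀ ⦃W : B⦄ (k : M ⟶ W), i ≫ k = 0 → ∃ l : Q ⟶ W, p ≫ l = k) :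
    IsShortExactSeq i p :=
  ⟨w, ⟨KernelFork.IsLimit.ofι' i w fun k hk => ⟨_, (lift k hk).choose_spec⟩⟩,
    ⟨CokernelCofork.IsColimit.ofπ' p w fun k hk => ⟨_, (desc k hk).choose_spec⟩⟩⟩

lemma of_iso {M' : B} (h : IsShortExactSeq i p) (e : M ≅ M') :
    IsShortExactSeq (i ≫ e.hom) (e.inv ≫ p) := by
  have := h.mono
  have := h.epi
  refine of_exists (by simp [h.zero]) (fun W k hk => ?_) (fun W k hk => ?_)
  · obtain ⟨l, hl⟩ := h.exists_lift (k ≫ e.inv) (by simpa using hk)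
    exact ⟨l, by rw [← Category.assoc, hl]; simp⟩
  · obtain ⟨l, hl⟩ := h.exists_desc (e.hom ≫ k) (by simpa using hk)
    exact ⟨l, by rw [Category.assoc, hl]; simp⟩

lemma iso_comp {K' : B} (h : IsShortExactSeq i p) (e : K' ⟶ K) [IsIso e] :
    IsShortExactSeq (e ≫ i) p := by
  have := h.mono
  have := h.epi
  refine of_exists (by simp [h.zero]) (fun W k hk => ?_) (fun W k hk => ?_)
  · obtain ⟨l, hl⟩ := h.exists_lift k hk
    exact ⟨l ≫ inv e, by simpa using hl⟩
  · exact h.exists_desc k (by rwa [Category.assoc, ← cancel_epi e, comp_zero] at *)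

lemma comp_iso {Q' : B} (h : IsShortExactSeq i p) (e : Q ⟶ Q') [IsIso e] :
    IsShortExactSeq i (p ≫ e) := by
  have := h.mono
  have := h.epi
  refine of_exists (by rw [← Category.assoc, h.zero, zero_comp]) (fun W k hk => ?_)
    (fun W k hk => ?_)
  · exact h.exists_lift k (by rwa [← Category.assoc, ← cancel_mono e, zero_comp] at *)
  · obtain ⟨l, hl⟩ := h.exists_desc k hk
    exact ⟨inv e ≫ l, by simpa using hl⟩

end IsShortExactSeq

lemma isClosedUnderIsomorphisms_star (P Q : ObjectProperty B) :
    (star P Q).IsClosedUnderIsomorphisms where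
  of_iso e := fun ⟨_, _, _, _, hP, hQ, h⟩ => ⟨_, _, _, _, hP, hQ, h.of_iso e⟩

/-! ### Torsion pairs: automatic approximations and closure properties -/

namespace IsTorsionPair

variable {T F : ObjectProperty B}

/-- Hom-vanishing makes the torsion subobject itself an approximation. -/
lemma contravariantlyFinite (h : IsTorsionPair T F) : ContravariantlyFinite T := by
  intro M
  obtain ⟨X, Y, i, p, hX, hY, hs⟩ := h.exists_shortExact M
  exact ⟨X, i, hX, fun X' hX' f => hs.exists_lift f (h.hom_eq_zero hX' hY _)⟩

lemma covariantlyFinite (h : IsTorsionPair T F) : CovariantlyFinite F := by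
  intro M
  obtain ⟨X, Y, i, p, hX, hY, hs⟩ := h.exists_shortExact M
  exact ⟨Y, p, hY, fun Y' hY' f => hs.exists_desc f (h.hom_eq_zero hX hY' _)⟩

/-- An object without nonzero morphisms to the torsion-free class is torsion. -/
lemma torsion_of_hom_eq_zero (h : IsTorsionPair T F) {M : B}
    (hM : ∀ ⦃Y : B⦄, F Y → ∀ f : M ⟶ Y, f = 0) : T M := by
  -- Here `p = 0`, so the identity of `M` factors through the monomorphism `i`, which is then
  -- invertible.
  obtain ⟨X, Y, i, p, hX, hY, hs⟩ := h.exists_shortExact M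
  have := hs.mono
  obtain ⟨l, hl⟩ := hs.exists_lift (𝟙 M) (by rw [hM hY p, comp_zero])
  have := h.isoClosed_torsion
  exact T.prop_of_iso ⟨i, l, by rw [← cancel_mono i, Category.assoc, hl]; simp, hl⟩ hX

/-- An object without nonzero morphisms from the torsion class is torsion-free. -/
lemma torsionfree_of_hom_eq_zero (h : IsTorsionPair T F) {M : B}
    (hM : ∀ ⦃X : B⦄, T X → ∀ f : X ⟶ M, f = 0) : F M := by
  obtain ⟨X, Y, i, p, hX, hY, hs⟩ := h.exists_shortExact M
  have := hs.epi
  obtain ⟨l, hl⟩ := hs.exists_desc (𝟙 M) (by rw [hM hX i, zero_comp])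
  have := h.isoClosed_torsionfree
  exact F.prop_of_iso ⟨l, p, by rw [← cancel_epi p, ← Category.assoc, hl]; simp, hl⟩ hY

lemma torsion_of_epi (h : IsTorsionPair T F) {M N : B} (p : M ⟶ N) [Epi p] (hM : T M) : T N :=
  h.torsion_of_hom_eq_zero fun Y hY f => by
    rw [← cancel_epi p, h.hom_eq_zero hM hY (p ≫ f), comp_zero]

lemma torsionfree_of_mono (h : IsTorsionPair T F) {M N : B} (i : M ⟶ N) [Mono i] (hN : F N) :
    F M :=
  h.torsionfree_of_hom_eq_zero fun X hX f => by
    rw [← cancel_mono i, h.hom_eq_zero hX hN (f ≫ i), zero_comp]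

lemma torsionfree_le (h : IsTorsionPair T F) {T' F' : ObjectProperty B}
    (h' : IsTorsionPair T' F') (hle : T ≤ T') : F' ≤ F := fun _ hM =>
  h.torsionfree_of_hom_eq_zero fun _ hX f => h'.hom_eq_zero (hle _ hX) hM f

/-- Passing to torsion-free quotients preserves covariant finiteness of classes closed under
quotients. -/
lemma covariantlyFinite_inf (h : IsTorsionPair T F) {P : ObjectProperty B}
    (hP : ∀ ⦃M N : B⦄ (p : M ⟶ N), Epi p → P M → P N) (hfin : CovariantlyFinite P) :
    CovariantlyFinite (P ⊓ F) := by
  intro M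
  obtain ⟨M₀, α, hM₀, hα⟩ := hfin M
  obtain ⟨X, Y, i, p, hX, hY, hs⟩ := h.exists_shortExact M₀
  refine ⟨Y, α ≫ p, ⟨hP p hs.epi hM₀, hY⟩, fun N hN f => ?_⟩
  obtain ⟨g, hg⟩ := hα hN.1 f
  obtain ⟨l, hl⟩ := hs.exists_desc g (h.hom_eq_zero hX hN.2 _)
  exact ⟨l, by rw [Category.assoc, hl, hg]⟩

/-- Passing to torsion subobjects preserves contravariant finiteness of classes closed under
subobjects. -/
lemma contravariantlyFinite_inf (h : IsTorsionPair T F) {P : ObjectProperty B}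
    (hP : ∀ ⦃M N : B⦄ (i : M ⟶ N), Mono i → P N → P M) (hfin : ContravariantlyFinite P) :
    ContravariantlyFinite (P ⊓ T) := by
  intro M
  obtain ⟨M₀, α, hM₀, hα⟩ := hfin M
  obtain ⟨X, Y, i, p, hX, hY, hs⟩ := h.exists_shortExact M₀
  refine ⟨X, i ≫ α, ⟨hP i hs.mono hM₀, hX⟩, fun N hN f => ?_⟩
  obtain ⟨g, hg⟩ := hα hN.1 f
  obtain ⟨l, hl⟩ := hs.exists_lift g (h.hom_eq_zero hN.2 hY _)
  exact ⟨l, by rw [← Category.assoc, hl, hg]⟩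

end IsTorsionPair

/-! ### Restriction to the heart -/

section FullSubcategory

variable {H : ObjectProperty B}

/-- A short exact sequence of the ambient category with terms in a full subcategory is short
exact in the full subcategory. -/
lemma IsShortExactSeq.fullSubcategory {K M Q : H.FullSubcategory} {i : K.obj ⟶ M.obj}
    {p : M.obj ⟶ Q.obj} (h : IsShortExactSeq i p) :
    IsShortExactSeq (ObjectProperty.homMk i : K ⟶ M) (ObjectProperty.homMk p : M ⟶ Q) := by
  have hi := h.mono
  have hp := h.epi
  have : Mono (ObjectProperty.homMk i : K ⟶ M) := H.ι.mono_of_mono_map hi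
  have : Epi (ObjectProperty.homMk p : M ⟶ Q) := H.ι.epi_of_epi_map hp
  refine of_exists (by ext; exact h.zero) (fun W k hk => ?_) (fun W k hk => ?_)
  · obtain ⟨l, hl⟩ := h.exists_lift k.hom (congrArg (fun f => f.hom) hk)
    exact ⟨ObjectProperty.homMk l, by ext; exact hl⟩
  · obtain ⟨l, hl⟩ := h.exists_desc k.hom (congrArg (fun f => f.hom) hk)
    exact ⟨ObjectProperty.homMk l, by ext; exact hl⟩

end FullSubcategory

/-- Restriction of an intermediate torsion pair to the heart of twin torsion pairs. -/
lemma AreTwinTorsionPairs.restrict_heart {C D C' D' X Y : ObjectProperty B}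
    (h : AreTwinTorsionPairs C D C' D') (hXY : IsFunctoriallyFiniteTorsionPair X Y)
    (hCX : C ≤ X) (hXC' : X ≤ C') :
    IsFunctoriallyFiniteTorsionPairIn (C' ⊓ D) (X ⊓ D) (Y ⊓ C') := by
  have tp := hXY.isTorsionPair
  have hYD : Y ≤ D := h.fst.torsionfree_le tp hCX
  have h₁ : X ⊓ D ≤ C' ⊓ D := fun _ hM => ⟨hXC' _ hM.1, hM.2⟩
  have h₂ : Y ⊓ C' ≤ C' ⊓ D := fun _ hM => ⟨hM.2, hYD _ hM.1⟩
  have tp' : IsTorsionPair (B := (C' ⊓ D).FullSubcategory)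
      ((X ⊓ D).inverseImage (C' ⊓ D).ι) ((Y ⊓ C').inverseImage (C' ⊓ D).ι) := by
    have := tp.isoClosed_torsion
    have := tp.isoClosed_torsionfree
    have := h.fst.isoClosed_torsionfree
    have := h.snd.isoClosed_torsion
    refine ⟨inferInstance, inferInstance, fun M N hM hN f => ?_, fun M => ?_⟩
    · ext
      exact tp.hom_eq_zero hM.1 hN.1 f.hom
    · obtain ⟨U, V, i, p, hU, hV, hs⟩ := tp.exists_shortExact M.obj
      have := hs.mono
      have := hs.epi
      have hU' : (X ⊓ D) U := ⟨hU, h.fst.torsionfree_of_mono i M.property.2⟩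
      have hV' : (Y ⊓ C') V := ⟨hV, h.snd.torsion_of_epi p M.property.1⟩
      exact ⟨⟨U, h₁ _ hU'⟩, ⟨V, h₂ _ hV'⟩, ObjectProperty.homMk i, ObjectProperty.homMk p,
        hU', hV', IsShortExactSeq.fullSubcategory hs⟩
  refine ⟨h₁, h₂, tp', ⟨tp'.contravariantlyFinite, ?_⟩, ⟨?_, tp'.covariantlyFinite⟩⟩
  · exact (h.fst.covariantlyFinite_inf (fun _ _ p _ => tp.torsion_of_epi p)
      hXY.torsion_finite.2).inverseImage h₁
  · exact (h.snd.contravariantlyFinite_inf (fun _ _ i _ => tp.torsionfree_of_mono i)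
      hXY.torsionfree_finite.1).inverseImage h₂

end General

/-! ### Short exact sequences in an abelian category -/

section Abelian

variable {A : Type u} [Category.{v} A] [Abelian A]

namespace IsShortExactSeq

lemma of_shortExact {S : ShortComplex A} (h : S.ShortExact) : IsShortExactSeq S.f S.g :=
  ⟨S.zero, ⟨h.fIsKernel⟩, ⟨h.gIsCokernel⟩⟩

/-- An epimorphism is the cokernel of its kernel, so only the kernel property needs checking. -/
lemma of_epi {K M Q : A} {i : K ⟶ M} {p : M ⟶ Q} [Mono i] [Epi p] (w : i ≫ p = 0)
    (lift : ∀ ⦃W : A⦄ (k : W ⟶ M), k ≫ p = 0 → ∃ l : W ⟶ K, l ≫ i = k) :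
    IsShortExactSeq i p :=
  let hi := KernelFork.IsLimit.ofι' i w fun k hk => ⟨_, (lift k hk).choose_spec⟩
  ⟨w, ⟨hi⟩, ⟨Abelian.epiIsCokernelOfKernel _ hi⟩⟩

lemma of_mono {K M Q : A} {i : K ⟶ M} {p : M ⟶ Q} [Mono i] [Epi p] (w : i ≫ p = 0)
    (desc : ∀ ⦃W : A⦄ (k : M ⟶ W), i ≫ k = 0 → ∃ l : Q ⟶ W, p ≫ l = k) :
    IsShortExactSeq i p :=
  let hp := CokernelCofork.IsColimit.ofπ' p w fun k hk => ⟨_, (desc k hk).choose_spec⟩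
  ⟨w, ⟨Abelian.monoIsKernelOfCokernel _ hp⟩, ⟨hp⟩⟩

lemma kernel_of_epi {M Q : A} (p : M ⟶ Q) [Epi p] : IsShortExactSeq (kernel.ι p) p :=
  of_epi (kernel.condition p) fun _ k hk => ⟨kernel.lift p k hk, kernel.lift_ι p k hk⟩

lemma cokernel_of_mono {K M : A} (i : K ⟶ M) [Mono i] : IsShortExactSeq i (cokernel.π i) :=
  of_mono (cokernel.condition i) fun _ k hk => ⟨cokernel.desc i k hk, cokernel.π_desc i k hk⟩

/-- Pullback of a short exact sequence along a morphism to its quotient. -/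
lemma exists_pullback {K M Q Q' : A} {i : K ⟶ M} {p : M ⟶ Q} (h : IsShortExactSeq i p)
    (g : Q' ⟶ Q) : ∃ j : K ⟶ pullback p g, IsShortExactSeq j (pullback.snd p g) := by
  have := h.mono
  have := h.epi
  let j : K ⟶ pullback p g := pullback.lift i 0 (by rw [h.zero, zero_comp])
  have hj : j ≫ pullback.fst p g = i := pullback.lift_fst _ _ _
  have hj' : j ≫ pullback.snd p g = 0 := pullback.lift_snd _ _ _
  have : Mono (j ≫ pullback.fst p g) := by rw [hj]; infer_instance
  have : Mono j := mono_of_mono j (pullback.fst p g)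
  refine ⟨j, of_epi hj' fun W k hk => ?_⟩
  obtain ⟨l, hl⟩ := h.exists_lift (k ≫ pullback.fst p g) (by
    rw [Category.assoc, pullback.condition, ← Category.assoc, hk, zero_comp])
  refine ⟨l, pullback.hom_ext ?_ ?_⟩
  · rw [Category.assoc, hj, hl]
  · rw [Category.assoc, hj', hk, comp_zero]

/-- Pushout of a short exact sequence along a morphism from its subobject. -/
lemma exists_pushout {K K' M Q : A} {i : K ⟶ M} {p : M ⟶ Q} (h : IsShortExactSeq i p)
    (g : K ⟶ K') : ∃ q : pushout i g ⟶ Q, IsShortExactSeq (pushout.inr i g) q := by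
  have := h.mono
  have := h.epi
  let q : pushout i g ⟶ Q := pushout.desc p 0 (by rw [h.zero, comp_zero])
  have hq : pushout.inl i g ≫ q = p := pushout.inl_desc _ _ _
  have hq' : pushout.inr i g ≫ q = 0 := pushout.inr_desc _ _ _
  have : Epi (pushout.inl i g ≫ q) := by rw [hq]; infer_instance
  have : Epi q := epi_of_epi (pushout.inl i g) q
  refine ⟨q, of_mono hq' fun W k hk => ?_⟩
  obtain ⟨l, hl⟩ := h.exists_desc (pushout.inl i g ≫ k) (by
    rw [← Category.assoc, pushout.condition, Category.assoc, hk, comp_zero])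
  refine ⟨l, pushout.hom_ext ?_ ?_⟩
  · rw [← Category.assoc, hq, hl]
  · rw [← Category.assoc, hq', hk, zero_comp]

/-- The preimage, under the quotient of a short exact sequence, of a subobject of the quotient. -/
lemma exists_preimage {K M N X Y : A} {c : K ⟶ M} {d : M ⟶ N} {i : X ⟶ N} {p : N ⟶ Y}
    (h : IsShortExactSeq c d) (h' : IsShortExactSeq i p) :
    ∃ (L : A) (a : K ⟶ L) (b : L ⟶ X) (j : L ⟶ M),
      IsShortExactSeq a b ∧ IsShortExactSeq j (d ≫ p) := by
  have := h.epi
  have := h'.mono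
  have := h'.epi
  obtain ⟨a, ha⟩ := h.exists_pullback i
  refine ⟨_, a, _, pullback.fst d i, ha, of_epi ?_ fun W k hk => ?_⟩
  · rw [← Category.assoc, pullback.condition, Category.assoc, h'.zero, comp_zero]
  · obtain ⟨l, hl⟩ := h'.exists_lift (k ≫ d) (by rw [Category.assoc, hk])
    exact ⟨pullback.lift k l hl.symm, pullback.lift_fst _ _ _⟩

/-- The quotient by a subobject of the subobject of a short exact sequence. -/
lemma exists_quotient {L N M X Y : A} {j : L ⟶ N} {r : N ⟶ X} {a : N ⟶ M} {b : M ⟶ Y}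
    (h : IsShortExactSeq j r) (h' : IsShortExactSeq a b) :
    ∃ (V : A) (c : X ⟶ V) (d : V ⟶ Y) (s : M ⟶ V),
      IsShortExactSeq c d ∧ IsShortExactSeq (j ≫ a) s := by
  have := h.mono
  have := h.epi
  have := h'.mono
  obtain ⟨d, hd⟩ := h'.exists_pushout r
  refine ⟨_, _, d, pushout.inl a r, hd, of_mono ?_ fun W k hk => ?_⟩
  · rw [Category.assoc, pushout.condition, ← Category.assoc, h.zero, zero_comp]
  · obtain ⟨l, hl⟩ := h.exists_desc (a ≫ k) (by rw [← Category.assoc, hk])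
    exact ⟨pushout.desc k l hl.symm, pushout.inl_desc _ _ _⟩

end IsShortExactSeq

/-- A kernel relative to the heart differs from the kernel in the abelian category by a
torsion-free quotient. -/
lemma IsTorsionPair.exists_shortExact_kernel {T F D : ObjectProperty A} (h : IsTorsionPair T F)
    (hD : ∀ ⦃M N : A⦄ (i : M ⟶ N), Mono i → D N → D M)
    {X N Y : A} {i : X ⟶ N} {p : N ⟶ Y} (w : i ≫ p = 0) (hX : T X) (hX' : D X) (hN : D N)
    (lift : ∀ ⦃W : A⦄, T W → D W → ∀ k : W ⟶ N, k ≫ p = 0 → ∃ l : W ⟶ X, l ≫ i = k)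
    (uniq : ∀ ⦃W : A⦄, T W → D W → ∀ k l : W ⟶ X, k ≫ i = l ≫ i → k = l) :
    ∃ (V : A) (q : kernel p ⟶ V), F V ∧ IsShortExactSeq (kernel.lift p i w) q := by
  obtain ⟨U, V, j, q, hU, hV, hs⟩ := h.exists_shortExact (kernel p)
  have := hs.mono
  -- Being a subobject of `N`, the torsion part `U` of the kernel lies in `T ⊓ D`. Then `X` and `U`
  -- have the same universal property there, which forces `X ≅ U`.
  have hUD : D U := hD (j ≫ kernel.ι p) inferInstance hN
  obtain ⟨l, hl⟩ := lift hU hUD (j ≫ kernel.ι p) (by simp)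
  obtain ⟨m, hm⟩ := hs.exists_lift (kernel.lift p i w) (h.hom_eq_zero hX hV _)
  have hmi : m ≫ j ≫ kernel.ι p = i := by rw [← Category.assoc, hm, kernel.lift_ι]
  have : IsIso m := ⟨l, uniq hX hX' _ _ (by rw [Category.assoc, hl, hmi, Category.id_comp]), by
    rw [← cancel_mono (j ≫ kernel.ι p), Category.assoc, hmi, hl, Category.id_comp]⟩
  exact ⟨V, q, hV, hm ▸ hs.iso_comp m⟩

/-- A cokernel relative to the heart differs from the cokernel in the abelian category by a
torsion subobject. -/
lemma IsTorsionPair.exists_shortExact_cokernel {T F C : ObjectProperty A}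
    (h : IsTorsionPair T F) (hC : ∀ ⦃M N : A⦄ (p : M ⟶ N), Epi p → C M → C N)
    {X N Y : A} {i : X ⟶ N} {p : N ⟶ Y} (w : i ≫ p = 0) (hY : F Y) (hY' : C Y) (hN : C N)
    (desc : ∀ ⦃W : A⦄, F W → C W → ∀ k : N ⟶ W, i ≫ k = 0 → ∃ l : Y ⟶ W, p ≫ l = k)
    (uniq : ∀ ⦃W : A⦄, F W → C W → ∀ k l : Y ⟶ W, p ≫ k = p ≫ l → k = l) :
    ∃ (U : A) (j : U ⟶ cokernel i), T U ∧ IsShortExactSeq j (cokernel.desc i p w) := by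
  obtain ⟨U, V, j, q, hU, hV, hs⟩ := h.exists_shortExact (cokernel i)
  have := hs.epi
  have hVC : C V := hC (cokernel.π i ≫ q) inferInstance hN
  obtain ⟨l, hl⟩ := desc hV hVC (cokernel.π i ≫ q) (by simp)
  obtain ⟨m, hm⟩ := hs.exists_desc (cokernel.desc i p w) (h.hom_eq_zero hU hY _)
  have hmp : (cokernel.π i ≫ q) ≫ m = p := by rw [Category.assoc, hm, cokernel.π_desc]
  have : IsIso m := ⟨l, by
    rw [← cancel_epi (cokernel.π i ≫ q), ← Category.assoc, hmp, hl, Category.comp_id],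
    uniq hY hY' _ _ (by rw [← Category.assoc, hl, hmp, Category.comp_id])⟩
  exact ⟨U, j, hU, hm ▸ hs.comp_iso m⟩

/-- Short exact sequences of the heart of twin torsion pairs are short exact sequences of the
abelian category. -/
lemma AreTwinTorsionPairs.isShortExactSeq_of_heart {C D C' D' : ObjectProperty A}
    (h : AreTwinTorsionPairs C D C' D') {X N Y : (C' ⊓ D).FullSubcategory} {i : X ⟶ N}
    {p : N ⟶ Y} (hs : IsShortExactSeq i p) : IsShortExactSeq i.hom p.hom := by
  have hi := hs.mono
  have hp := hs.epi
  have w : i.hom ≫ p.hom = 0 := congrArg (fun f => f.hom) hs.zero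
  obtain ⟨V, q, hV, hq⟩ := h.snd.exists_shortExact_kernel
    (fun _ _ i _ => h.fst.torsionfree_of_mono i) w X.property.1 X.property.2 N.property.2
    (fun W hW hW' k hk => by
      obtain ⟨l, hl⟩ := hs.exists_lift (W := ⟨W, hW, hW'⟩) (ObjectProperty.homMk k)
        (by ext; exact hk)
      exact ⟨l.hom, congrArg (fun f => f.hom) hl⟩)
    (fun W hW hW' k l hkl => by
      have : (ObjectProperty.homMk k : (⟨W, hW, hW'⟩ : (C' ⊓ D).FullSubcategory) ⟶ X) =
          ObjectProperty.homMk l := by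
        rw [← cancel_mono i]
        ext
        exact hkl
      exact congrArg (fun f => f.hom) this)
  obtain ⟨U, j, hU, hj⟩ := h.fst.exists_shortExact_cokernel
    (fun _ _ p _ => h.snd.torsion_of_epi p) w Y.property.2 Y.property.1 N.property.1
    (fun W hW hW' k hk => by
      obtain ⟨l, hl⟩ := hs.exists_desc (W := ⟨W, hW', hW⟩) (ObjectProperty.homMk k)
        (by ext; exact hk)
      exact ⟨l.hom, congrArg (fun f => f.hom) hl⟩)
    (fun W hW hW' k l hkl => by
      have : (ObjectProperty.homMk k : Y ⟶ (⟨W, hW', hW⟩ : (C' ⊓ D).FullSubcategory)) =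
          ObjectProperty.homMk l := by
        rw [← cancel_epi p]
        ext
        exact hkl
      exact congrArg (fun f => f.hom) this)
  let S := ShortComplex.mk i.hom p.hom w
  have : Mono i.hom := by
    have := hq.mono
    rw [← kernel.lift_ι p.hom i.hom w]
    infer_instance
  have : Epi p.hom := by
    have := hj.epi
    rw [← cokernel.π_desc i.hom p.hom w]
    infer_instance
  -- The homology of `S` is computed twice: as the cokernel `V` of `X ⟶ kernel p`, and as the kernel
  -- `U` of `cokernel i ⟶ Y`.
  let l : S.LeftHomologyData :=
    { K := kernel p.hom
      H := V
      i := kernel.ι p.hom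
      π := q
      wi := kernel.condition p.hom
      hi := kernelIsKernel p.hom
      wπ := hq.zero
      hπ := hq.choose_spec.2.some }
  let r : S.RightHomologyData :=
    { Q := cokernel i.hom
      H := U
      p := cokernel.π i.hom
      ι := j
      wp := cokernel.condition i.hom
      hp := cokernelIsCokernel i.hom
      wι := hj.zero
      hι := hj.choose_spec.1.some }
  let e : U ≅ V := r.homologyIso.symm ≪≫ l.homologyIso
  -- The isomorphism `U ≅ V` goes from `C ≤ C'` to `D'`, so it is zero and `V` vanishes.
  have hS : S.Exact := by
    rw [l.exact_iff, IsZero.iff_id_eq_zero, ← cancel_epi e.hom,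
      h.snd.hom_eq_zero (h.le _ hU) hV (e.hom ≫ 𝟙 _), comp_zero]
  exact IsShortExactSeq.of_shortExact (S := S) ⟨hS⟩

/-- In an abelian category with enough projectives, extensions of covariantly finite classes are
covariantly finite. -/
lemma CovariantlyFinite.star [EnoughProjectives A] {P Q : ObjectProperty A}
    (hP : CovariantlyFinite P) (hQ : CovariantlyFinite Q) : CovariantlyFinite (star P Q) := by
  intro M
  obtain ⟨Z, α, hZ, hα⟩ := hQ M
  -- The approximation `α` need not be epi; a projective summand makes it so, and maps out of that
  -- summand lift along any `p`.
  let π := biprod.desc α (Projective.π Z)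
  have : Epi π := by
    have : Epi (biprod.inr ≫ π) := by
      rw [biprod.inr_desc]
      infer_instance
    exact epi_of_epi biprod.inr π
  obtain ⟨X, β, hX, hβ⟩ := hP (kernel π)
  obtain ⟨q, hq⟩ := (IsShortExactSeq.kernel_of_epi π).exists_pushout β
  refine ⟨_, biprod.inl ≫ pushout.inl (kernel.ι π) β, ⟨X, Z, _, q, hX, hZ, hq⟩, ?_⟩
  rintro E ⟨X', Z', i, p, hX', hZ', hs⟩ f
  have := hs.epi
  obtain ⟨g, hg⟩ := hα hZ' (f ≫ p)
  let t := Projective.factorThru (Projective.π Z ≫ g) p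
  have ht : t ≫ p = Projective.π Z ≫ g := Projective.factorThru_comp _ _
  have hft : biprod.desc f t ≫ p = π ≫ g := by
    ext <;> simp [π, hg, ht]
  -- The extended map sends `kernel π` into `X'`, hence factors there through `β` and glues over the
  -- pushout.
  obtain ⟨k, hk⟩ := hs.exists_lift (kernel.ι π ≫ biprod.desc f t) (by
    rw [Category.assoc, hft, ← Category.assoc, kernel.condition, zero_comp])
  obtain ⟨k', hk'⟩ := hβ hX' k
  refine ⟨pushout.desc (biprod.desc f t) (k' ≫ i) (by rw [← hk, ← hk', Category.assoc]), ?_⟩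
  rw [Category.assoc, pushout.inl_desc, biprod.inl_desc]

/-- In an abelian category with enough injectives, extensions of contravariantly finite classes
are contravariantly finite. -/
lemma ContravariantlyFinite.star [EnoughInjectives A] {P Q : ObjectProperty A}
    (hP : ContravariantlyFinite P) (hQ : ContravariantlyFinite Q) :
    ContravariantlyFinite (star P Q) := by
  intro M
  obtain ⟨X, α, hX, hα⟩ := hP M
  let ι := biprod.lift α (Injective.ι X)
  have : Mono ι := by
    have : Mono (ι ≫ biprod.snd) := by
      rw [biprod.lift_snd]
      infer_instance
    exact mono_of_mono ι biprod.snd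
  obtain ⟨Z, β, hZ, hβ⟩ := hQ (cokernel ι)
  obtain ⟨j, hj⟩ := (IsShortExactSeq.cokernel_of_mono ι).exists_pullback β
  refine ⟨_, pullback.fst (cokernel.π ι) β ≫ biprod.fst, ⟨X, Z, j, _, hX, hZ, hj⟩, ?_⟩
  rintro E ⟨X', Z', i, p, hX', hZ', hs⟩ f
  have := hs.mono
  obtain ⟨g, hg⟩ := hα hX' (i ≫ f)
  let t := Injective.factorThru (g ≫ Injective.ι X) i
  have ht : i ≫ t = g ≫ Injective.ι X := Injective.comp_factorThru _ _
  have hft : i ≫ biprod.lift f t = g ≫ ι := by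
    ext <;> simp [ι, hg, ht]
  obtain ⟨k, hk⟩ := hs.exists_desc (biprod.lift f t ≫ cokernel.π ι) (by
    rw [← Category.assoc, hft, Category.assoc, cokernel.condition, comp_zero])
  obtain ⟨k', hk'⟩ := hβ hZ' k
  refine ⟨pullback.lift (biprod.lift f t) (p ≫ k') (by rw [← hk, ← hk', Category.assoc]), ?_⟩
  rw [← Category.assoc, pullback.lift_fst, biprod.lift_fst]

/-- Morphisms between extensions vanish if they do between the classes being extended. -/
lemma star_hom_eq_zero {P Q R S : ObjectProperty A}
    (hPR : ∀ ⦃X Y : A⦄, P X → R Y → ∀ f : X ⟶ Y, f = 0)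
    (hPS : ∀ ⦃X Y : A⦄, P X → S Y → ∀ f : X ⟶ Y, f = 0)
    (hQR : ∀ ⦃X Y : A⦄, Q X → R Y → ∀ f : X ⟶ Y, f = 0)
    (hQS : ∀ ⦃X Y : A⦄, Q X → S Y → ∀ f : X ⟶ Y, f = 0)
    ⦃X Y : A⦄ (hX : star P Q X) (hY : star R S Y) (f : X ⟶ Y) : f = 0 := by
  obtain ⟨X₁, X₂, i, p, hX₁, hX₂, hs⟩ := hX
  obtain ⟨Y₁, Y₂, j, q, hY₁, hY₂, ht⟩ := hY
  obtain ⟨g, hg⟩ := hs.exists_desc (f ≫ q) (by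
    rw [hPS hX₁ hY₂ (i ≫ f ≫ q)])
  obtain ⟨k, hk⟩ := ht.exists_lift f (by rw [← hg, hQS hX₂ hY₂ g, comp_zero])
  obtain ⟨l, hl⟩ := hs.exists_desc k (hPR hX₁ hY₁ _)
  rw [← hk, ← hl, hQR hX₂ hY₁ l, comp_zero, zero_comp]

/-- A torsion pair in the heart of twin torsion pairs extends to a torsion pair in the abelian
category. -/
lemma AreTwinTorsionPairs.isTorsionPair_star {C D C' D' T F : ObjectProperty A}
    (h : AreTwinTorsionPairs C D C' D') (hT : T ≤ C' ⊓ D) (hF : F ≤ C' ⊓ D)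
    (hTF : IsTorsionPair (B := (C' ⊓ D).FullSubcategory)
      (T.inverseImage (C' ⊓ D).ι) (F.inverseImage (C' ⊓ D).ι)) :
    IsTorsionPair (star C T) (star F D') := by
  refine ⟨isClosedUnderIsomorphisms_star _ _, isClosedUnderIsomorphisms_star _ _,
    star_hom_eq_zero ?_ ?_ ?_ ?_, fun M => ?_⟩
  · exact fun X Y hX hY f => h.fst.hom_eq_zero hX (hF _ hY).2 f
  · exact fun X Y hX hY f => h.snd.hom_eq_zero (h.le _ hX) hY f
  · intro X Y hX hY f
    exact congrArg (fun f => f.hom) (hTF.hom_eq_zero (X := ⟨X, hT _ hX⟩) (Y := ⟨Y, hF _ hY⟩)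
      hX hY (ObjectProperty.homMk f))
  · exact fun X Y hX hY f => h.snd.hom_eq_zero (hT _ hX).1 hY f
  -- `N` is the `C'`-part `M₁` of `M` modulo its `C`-part `M₀`. The preimage `L` in `M₁` of the
  -- `T`-part of `N` is the required torsion subobject of `M`.
  · obtain ⟨M₁, M₂, a, b, hM₁, hM₂, hab⟩ := h.snd.exists_shortExact M
    obtain ⟨M₀, N, c, d, hM₀, hN, hcd⟩ := h.fst.exists_shortExact M₁
    have := hcd.epi
    obtain ⟨X, Y, i, p, hX, hY, hip⟩ :=
      hTF.exists_shortExact ⟨N, h.snd.torsion_of_epi d hM₁, hN⟩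
    obtain ⟨L, _, _, j, hL, hj⟩ := hcd.exists_preimage (h.isShortExactSeq_of_heart hip)
    obtain ⟨V, _, _, s, hV, hs⟩ := hj.exists_quotient hab
    exact ⟨L, V, _, s, ⟨_, _, _, _, hM₀, hX, hL⟩, ⟨_, _, _, _, hY, hM₂, hV⟩, hs⟩

/-- A functorially finite torsion pair in the heart of functorially finite twin torsion pairs
extends to a functorially finite torsion pair in the abelian category. -/
lemma AreTwinTorsionPairs.isFunctoriallyFiniteTorsionPair_star [EnoughProjectives A]
    [EnoughInjectives A] {C D C' D' T F : ObjectProperty A}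
    (h : AreTwinTorsionPairs C D C' D') (hCD : IsFunctoriallyFiniteTorsionPair C D)
    (hCD' : IsFunctoriallyFiniteTorsionPair C' D')
    (hTF : IsFunctoriallyFiniteTorsionPairIn (C' ⊓ D) T F) :
    IsFunctoriallyFiniteTorsionPair (star C T) (star F D') := by
  obtain ⟨hT, hF, tp, hTfin, hFfin⟩ := hTF
  have tp' := h.isTorsionPair_star hT hF tp
  -- Left approximations by the heart come from `C'`, closed under quotients; right ones come from
  -- `D`, closed under subobjects.
  have hcov : CovariantlyFinite (C' ⊓ D) :=
    h.fst.covariantlyFinite_inf (fun _ _ p _ => h.snd.torsion_of_epi p) hCD'.torsion_finite.2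
  have hcontra : ContravariantlyFinite (C' ⊓ D) := by
    rw [inf_comm]
    exact h.snd.contravariantlyFinite_inf (fun _ _ i _ => h.fst.torsionfree_of_mono i)
      hCD.torsionfree_finite.1
  exact ⟨tp',
    ⟨tp'.contravariantlyFinite, hCD.torsion_finite.2.star (.of_inverseImage hT hcov hTfin.2)⟩,
    ⟨(ContravariantlyFinite.of_inverseImage hF hcontra hFfin.1).star hCD'.torsionfree_finite.1,
      tp'.covariantlyFinite⟩⟩

end Abelian

end HeartTorsion

theorem proposition4p6 {A : Type u} [Category.{v} A] [Abelian A]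
    (C D C' D' : ObjectProperty A)
    (htwin : HeartTorsion.AreTwinTorsionPairs C D C' D') :
    (∀ X Y : ObjectProperty A,
      HeartTorsion.IsFunctoriallyFiniteTorsionPair X Y → C ≤ X → X ≤ C' →
        HeartTorsion.IsFunctoriallyFiniteTorsionPairIn (C' ⊓ D) (X ⊓ D) (Y ⊓ C')) ∧
    (EnoughProjectives A → EnoughInjectives A →
      HeartTorsion.IsFunctoriallyFiniteTorsionPair C D →
      HeartTorsion.IsFunctoriallyFiniteTorsionPair C' D' →
      ∀ T F : ObjectProperty A,
        HeartTorsion.IsFunctoriallyFiniteTorsionPairIn (C' ⊓ D) T F →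
          HeartTorsion.IsFunctoriallyFiniteTorsionPair
            (HeartTorsion.star C T) (HeartTorsion.star F D')) :=
  ⟨fun _ _ hXY hCX hXC' => htwin.restrict_heart hXY hCX hXC',
    fun _ _ hCD hCD' _ _ hTF => htwin.isFunctoriallyFiniteTorsionPair_star hCD hCD' hTF⟩
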